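/- Let $\mathcal{M}=(M,\mathcal{O}_M)$ be a graded manifold: $M$ is a Hausdorff, second countable space, and $\mathcal{O}_M$ is a sheaf of graded commutative $\mathbb{Z}$-graded real algebras locally isomorphic to $(U,\, C^\infty(U)\otimes S(W^*))$ with $U\subseteq\mathbb{R}^n$ open and $W$ a finite-dimensional graded vector space. A vector field of degree $l$ on $\mathcal{M}$ is a graded derivation of degree $l$ of the algebra $C^\infty(\mathcal{M})$ of global sections, and $E$ denotes the Euler vector field, $E(f)=|f|f$. Differential forms are the smooth functions on $T[1]\mathcal{M}$, with de Rham differential $d$; the degree of a form is its total degree minus its form degree; $\iota_X$ denotes contraction and $L_X=\iota_X d+(-1)^{|X|}d\,\iota_X$ the Lie derivative. A graded symplectic form of degree $k$ is a closed two-form $\omega$ of degree $k$ for which $X\mapsto\iota_X\omega$ is an isomorphism $T\mathcal{M}\to T^*[k]\mathcal{M}$. **Lemma.** Let $\omega$ be a graded symplectic form of degree $k$ on $\mathcal{M}$ and let $X$ be a vector field of degree $l$ on $\mathcal{M}$ that is symplectic, i.e. $L_X\omega=0$. If $k+l\neq 0$, then $X$ is Hamiltonian, i.e. there is a smooth function $H\in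 C^\infty(\mathcal{M})$ with $\iota_X\omega=dH$. More precisely, $$\iota_X\omega = dH \qquad\text{for}\qquad H=\frac{\iota_E\,\iota_X\,\omega}{k+l}.$$ -/

import Mathlib

open TopologicalSpace
open scoped TensorProduct

universe u v

namespace GradedGeometry

/-! ## Graded commutative algebras, vector fields, differential forms

`A` is the algebra of smooth functions, `𝒜 k` is its part of degree `k`. The sign `(-1) ^ n` of an
integer `n` is `n.negOnePow`. -/

section Algebra

variable {A : Type v} [Ring A] [Algebra ℝ A]

/-- `a b = (-1) ^ (|a| |b|) b a` for homogeneous `a`, `b`. -/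
def IsGradedCommutative (𝒜 : ℤ → Submodule ℝ A) : Prop :=
  ∀ i j : ℤ, ∀ a ∈ 𝒜 i, ∀ b ∈ 𝒜 j, a * b = (i * j).negOnePow • (b * a)

/-- Graded vector fields of degree `l`: graded derivations `A → A[l]`, i.e. linear maps `X` that
send `𝒜 m` to `𝒜 (m + l)` and satisfy `X (f g) = X f g + (-1) ^ (l |f|) f X g`. -/
def VectorField (𝒜 : ℤ → Submodule ℝ A) (l : ℤ) : Submodule ℝ (A →ₗ[ℝ] A) where
  carrier := {X | (∀ m : ℤ, ∀ f ∈ 𝒜 m, X f ∈ 𝒜 (m + l)) ∧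
    ∀ m : ℤ, ∀ f ∈ 𝒜 m, ∀ g : A, X (f * g) = X f * g + (l * m).negOnePow • (f * X g)}
  zero_mem' := by
    refine ⟨fun m f _ => ?_, fun m f _ g => ?_⟩ <;> simp
  add_mem' := by
    rintro X Y ⟨hX, hX'⟩ ⟨hY, hY'⟩
    refine ⟨fun m f hf => ?_, fun m f hf g => ?_⟩
    · exact Submodule.add_mem _ (hX m f hf) (hY m f hf)
    · simp only [LinearMap.add_apply, hX' m f hf g, hY' m f hf g, add_mul, mul_add, smul_add]
      abel
  smul_mem' := by
    rintro c X ⟨hX, hX'⟩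
    refine ⟨fun m f hf => ?_, fun m f hf g => ?_⟩
    · exact Submodule.smul_mem _ c (hX m f hf)
    · simp only [LinearMap.smul_apply, hX' m f hf g, smul_add, smul_mul_assoc, mul_smul_comm]
      rw [smul_comm c]

/-- The product `f X` of a function of degree `n` and a vector field of degree `l`. -/
def mulVectorField {𝒜 : ℤ → Submodule ℝ A} [GradedAlgebra 𝒜] (hc : IsGradedCommutative 𝒜)
    {n l : ℤ} (f : 𝒜 n) (X : VectorField 𝒜 l) : VectorField 𝒜 (n + l) :=
  ⟨LinearMap.mulLeft ℝ (f : A) ∘ₗ X.1, by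
    refine ⟨fun m g hg => ?_, fun m g hg h => ?_⟩
    · have := SetLike.mul_mem_graded f.2 (X.2.1 m g hg)
      simpa [add_left_comm] using this
    · have h1 := hc n m f f.2 g hg
      simp only [LinearMap.comp_apply, LinearMap.mulLeft_apply, X.2.2 m g hg h, mul_add,
        mul_smul_comm, ← mul_assoc, h1, add_mul, Int.negOnePow_add, mul_smul, smul_mul_assoc]
      rw [smul_comm]⟩

/-- The graded commutator `[X, Y] = X ∘ Y - (-1) ^ (|X| |Y|) Y ∘ X`. -/
def bracket {𝒜 : ℤ → Submodule ℝ A} {l m : ℤ}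
    (X : VectorField 𝒜 l) (Y : VectorField 𝒜 m) : VectorField 𝒜 (l + m) :=
  ⟨X.1 ∘ₗ Y.1 - (l * m).negOnePow • (Y.1 ∘ₗ X.1), by
    have key : ∀ (f : A), (X.1 ∘ₗ Y.1 - (l * m).negOnePow • (Y.1 ∘ₗ X.1)) f =
        X.1 (Y.1 f) - (l * m).negOnePow • Y.1 (X.1 f) := fun f => rfl
    have hX : ∀ (u : ℤˣ) (f : A), X.1 (u • f) = u • X.1 f := fun u f => by
      simp only [Units.smul_def, map_zsmul]
    have hY : ∀ (u : ℤˣ) (f : A), Y.1 (u • f) = u • Y.1 f := fun u f => by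
      simp only [Units.smul_def, map_zsmul]
    refine ⟨fun n f hf => ?_, fun n f hf g => ?_⟩
    · rw [key, Units.smul_def]
      refine Submodule.sub_mem _ ?_ (zsmul_mem ?_ _)
      · have := X.2.1 _ _ (Y.2.1 n f hf)
        rwa [show n + m + l = n + (l + m) by ring] at this
      · have := Y.2.1 _ _ (X.2.1 n f hf)
        rwa [add_assoc] at this
    · rw [key, key, key, Y.2.2 n f hf g, X.2.2 n f hf g, map_add, map_add, hX, hY,
        X.2.2 _ _ (Y.2.1 n f hf) g, X.2.2 n f hf (Y.1 g), Y.2.2 _ _ (X.2.1 n f hf) g,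
        Y.2.2 n f hf (X.1 g)]
      simp only [mul_add, add_mul, Int.negOnePow_add, mul_smul, smul_add, sub_mul, mul_sub,
        smul_sub, smul_mul_assoc, mul_smul_comm, mul_comm m l]
      rcases Int.units_eq_one_or (l * m).negOnePow with h1 | h1 <;>
        rcases Int.units_eq_one_or (l * n).negOnePow with h2 | h2 <;>
        rcases Int.units_eq_one_or (m * n).negOnePow with h3 | h3 <;>
        simp only [h1, h2, h3, one_smul, Units.neg_smul] <;> abel⟩

/-- The Euler vector field `E f = |f| f`: it multiplies the part of degree `k` by `k`. -/
def euler (𝒜 : ℤ → Submodule ℝ A) [GradedAlgebra 𝒜] : VectorField 𝒜 0 :=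
  ⟨(DirectSum.toModule ℝ ℤ A fun k => (k : ℝ) • (𝒜 k).subtype) ∘ₗ
      (DirectSum.decomposeLinearEquiv 𝒜).toLinearMap, by
    have key : ∀ (k : ℤ), ∀ f ∈ 𝒜 k,
        ((DirectSum.toModule ℝ ℤ A fun k => (k : ℝ) • (𝒜 k).subtype) ∘ₗ
          (DirectSum.decomposeLinearEquiv 𝒜).toLinearMap) f = (k : ℝ) • f := by
      intro k f hf
      lift f to 𝒜 k using hf
      simp [DirectSum.toModule_lof]
    refine ⟨fun m f hf => ?_, fun m f hf g => ?_⟩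
    · rw [key m f hf, add_zero]
      exact Submodule.smul_mem _ _ hf
    · induction g using DirectSum.Decomposition.inductionOn 𝒜 with
      | zero => simp
      | @homogeneous i g =>
        rw [key m f hf, key i g g.2, key (m + i) _ (SetLike.mul_mem_graded hf g.2)]
        simp [add_smul]
      | add g h hg hh =>
        rw [mul_add, map_add, hg, hh, map_add]
        simp only [mul_add, smul_add]
        abel⟩

/-- Functions of `p` homogeneous vector fields with values in `A`, in curried form: the value of `α`
on `X₁, …, X_p` is `ι_{X_p} ⋯ ι_{X_1} α`. Differential forms are singled out in `IsForm`. -/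
def Cochain (𝒜 : ℤ → Submodule ℝ A) : ℕ → Type v
  | 0 => A
  | p + 1 => ∀ l : ℤ, VectorField 𝒜 l → Cochain 𝒜 p

instance instAddCommGroupCochain (𝒜 : ℤ → Submodule ℝ A) : ∀ p, AddCommGroup (Cochain 𝒜 p)
  | 0 => inferInstanceAs (AddCommGroup A)
  | p + 1 =>
    letI := instAddCommGroupCochain 𝒜 p
    inferInstanceAs (AddCommGroup (∀ l : ℤ, VectorField 𝒜 l → Cochain 𝒜 p))

variable {𝒜 : ℤ → Submodule ℝ A}

/-- The contraction `ι_X α`. -/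
def contract {l : ℤ} (X : VectorField 𝒜 l) {p : ℕ} (α : Cochain 𝒜 (p + 1)) : Cochain 𝒜 p :=
  α l X

/-- The product `f α` with a function `f` of degree `n`, determined by the rule
`ι_Y (f α) = (-1) ^ (n (|Y| - 1)) f ι_Y α` (the operator `ι_Y` has degree `|Y| - 1`). -/
def cmul {n : ℤ} (f : 𝒜 n) : ∀ {p : ℕ}, Cochain 𝒜 p → Cochain 𝒜 p
  | 0, g => ((f : A) * (show A from g) : A)
  | p + 1, α => fun m Y => (n * (m - 1)).negOnePow • cmul f (p := p) (α m Y)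

/-- `α` is a differential `p`-form of degree `k` (total degree minus form degree), i.e. a function
on `T[1]ℳ` that is homogeneous polynomial of degree `p` along the fibres: an `A`-multilinear function
of `p` vector fields, `ι_{f X} α = f ι_X α`, that is graded symmetric for the shifted degrees
`|X| - 1`, that is, `ι_X ι_Y = (-1) ^ ((|X| - 1) (|Y| - 1)) ι_Y ι_X`. -/
def IsForm [GradedAlgebra 𝒜] (hc : IsGradedCommutative 𝒜) :
    ∀ (p : ℕ) (_k : ℤ), Cochain 𝒜 p → Prop
  | 0, k, f => (show A from f) ∈ 𝒜 k
  | p + 1, k, α =>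
    (∀ (l : ℤ) (X : VectorField 𝒜 l), IsForm hc p (k + l) (contract X α)) ∧
    (∀ (l : ℤ) (X Y : VectorField 𝒜 l), contract (X + Y) α = contract X α + contract Y α) ∧
    (∀ (n l : ℤ) (f : 𝒜 n) (X : VectorField 𝒜 l),
      contract (mulVectorField hc f X) α = cmul f (contract X α)) ∧
    match p, α with
    | 0, _ => True
    | _ + 1, α => ∀ (l m : ℤ) (X : VectorField 𝒜 l) (Y : VectorField 𝒜 m),
        contract X (contract Y α) =
          ((l - 1) * (m - 1)).negOnePow • contract Y (contract X α)

/-- The action of `X` on `A`-valued functions of vector fields by the graded Leibniz rule: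
`f ↦ X f` and `[X, ι_Y] = ι_{[X, Y]}`, so that
`(X α)(Y) = (-1) ^ (|X| (|Y| - 1)) (X (α(Y)) - α([X, Y]))`. -/
def act {l : ℤ} (X : VectorField 𝒜 l) : ∀ {p : ℕ}, Cochain 𝒜 p → Cochain 𝒜 p
  | 0, f => X.1 f
  | p + 1, α => fun m Y =>
    (l * (m - 1)).negOnePow • (act X (p := p) (contract Y α) - contract (bracket X Y) α)

/-- The de Rham differential: the (graded) Koszul formula for the exterior derivative of a
multilinear function of vector fields, written recursively in the number of arguments,
`(d f)(X) = X f` and `(d α)(X, …) = (X α)(…) - (-1) ^ |X| d (α(X, ·))(…)`. For a one-form,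
`± (d α)(X, Y) = X (α(Y)) - (-1) ^ (|X| |Y|) Y (α(X)) - α([X, Y])`.
In local coordinates, `d = ∑ dxⁱ ∂/∂xⁱ`. -/
def d : ∀ {p : ℕ}, Cochain 𝒜 p → Cochain 𝒜 (p + 1)
  | 0, f => fun _ X => X.1 f
  | p + 1, α => fun l X => act X α - l.negOnePow • d (p := p) (contract X α)

/-- The Lie derivative `L_X α = ι_X d α + (-1) ^ |X| d ι_X α`. -/
def lieDerivative {l : ℤ} (X : VectorField 𝒜 l) {p : ℕ} (α : Cochain 𝒜 (p + 1)) :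
    Cochain 𝒜 (p + 1) :=
  contract X (d α) + l.negOnePow • d (contract X α)

end Algebra

/-! ## Graded manifolds -/

section Manifold

/-- The relations `x_i x_j = (-1) ^ (|x_i| |x_j|) x_j x_i` between coordinates of degrees `w`. -/
inductive SymRel {J : Type} (w : J → ℤ) : FreeAlgebra ℝ J → FreeAlgebra ℝ J → Prop
  | swap (i j : J) : SymRel w (FreeAlgebra.ι ℝ i * FreeAlgebra.ι ℝ j)
      ((w i * w j).negOnePow • (FreeAlgebra.ι ℝ j * FreeAlgebra.ι ℝ i))

/-- The graded symmetric algebra `S(W*)` over the graded vector space `W*` with homogeneous basis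
`(x_j)` of degrees `w j`. -/
abbrev GradedSym {J : Type} (w : J → ℤ) : Type := RingQuot (SymRel w)

/-- The basis elements `x_j` of `W*` in `S(W*)`. -/
def GradedSym.coord {J : Type} (w : J → ℤ) (j : J) : GradedSym w :=
  RingQuot.mkAlgHom ℝ (SymRel w) (FreeAlgebra.ι ℝ j)

/-- The part of `S(W*)` of degree `k`, spanned by the monomials of degree `k`. -/
def GradedSym.degree {J : Type} (w : J → ℤ) (k : ℤ) : Submodule ℝ (GradedSym w) :=
  Submodule.span ℝ
    {a | ∃ L : List J, (L.map w).sum = k ∧ a = (L.map (GradedSym.coord w)).prod}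

section SmoothFun

open scoped Manifold ContDiff

/-- `C^∞(V)` for an open subset `V` of `ℝⁿ`. -/
abbrev SmoothFun {n : ℕ} (V : Opens (EuclideanSpace ℝ (Fin n))) : Type :=
  C^∞⟮𝓘(ℝ, EuclideanSpace ℝ (Fin n)), V; 𝓘(ℝ, ℝ), ℝ⟯

/-- Restriction of smooth functions. -/
noncomputable def SmoothFun.res {n : ℕ} {V V' : Opens (EuclideanSpace ℝ (Fin n))} (h : V' ≤ V)
    (f : SmoothFun V) : SmoothFun V' :=
  ContMDiffMap.restrictRingHom 𝓘(ℝ, EuclideanSpace ℝ (Fin n)) 𝓘(ℝ, ℝ) ℝ h f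

end SmoothFun

/-- A sheaf of graded commutative `ℤ`-graded real algebras on `M`. The sheaf axiom is that of the
category of graded algebras: it holds in each degree. -/
structure GradedAlgebraSheaf (M : Type u) [TopologicalSpace M] where
  /-- The algebra of sections over `U`. -/
  sections : Opens M → Type v
  [ring : ∀ U, Ring (sections U)]
  [algebra : ∀ U, Algebra ℝ (sections U)]
  /-- The sections of degree `k` over `U`. -/
  degree : ∀ U, ℤ → Submodule ℝ (sections U)
  [graded : ∀ U, GradedAlgebra (degree U)]
  comm : ∀ U, IsGradedCommutative (degree U)
  /-- Restriction. -/
  res : ∀ {U V : Opens M}, U ≤ V → sections V →ₐ[ℝ] sections U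
  res_mem : ∀ {U V : Opens M} (h : U ≤ V) (k : ℤ), ∀ f ∈ degree V k, res h f ∈ degree U k
  res_self : ∀ (U : Opens M) (f : sections U), res le_rfl f = f
  res_res : ∀ {U V W : Opens M} (h : U ≤ V) (h' : V ≤ W) (f : sections W),
    res h (res h' f) = res (h.trans h') f
  sheaf : ∀ (k : ℤ) {ι : Type u} (U : ι → Opens M) (f : ∀ i, sections (U i)),
    (∀ i, f i ∈ degree (U i) k) →
    (∀ i j, res (inf_le_left : U i ⊓ U j ≤ U i) (f i) =
      res (inf_le_right : U i ⊓ U j ≤ U j) (f j)) →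
    ∃! g : sections (⨆ i, U i), g ∈ degree (⨆ i, U i) k ∧ ∀ i, res (le_iSup U i) g = f i

attribute [instance] GradedAlgebraSheaf.ring GradedAlgebraSheaf.algebra GradedAlgebraSheaf.graded

/-- The open subset of the domain of a chart that corresponds to `V ⊆ ℝⁿ`. -/
def chartPreimage {M : Type u} [TopologicalSpace M] {n : ℕ}
    (φ : OpenPartialHomeomorph M (EuclideanSpace ℝ (Fin n)))
    (V : Opens (EuclideanSpace ℝ (Fin n))) : Opens M :=
  ⟨φ.source ∩ φ ⁻¹' V, φ.isOpen_inter_preimage V.isOpen⟩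

theorem chartPreimage_mono {M : Type u} [TopologicalSpace M] {n : ℕ}
    (φ : OpenPartialHomeomorph M (EuclideanSpace ℝ (Fin n)))
    {V V' : Opens (EuclideanSpace ℝ (Fin n))} (h : V' ≤ V) :
    chartPreimage φ V' ≤ chartPreimage φ V :=
  fun _ hx => ⟨hx.1, h hx.2⟩

/-- A chart: a homeomorphism `φ` of an open subset of `M` with an open subset `U` of `ℝⁿ`, together
with an isomorphism of the restricted sheaf with the local model `(U, C^∞(U) ⊗ S(W*))`, where `W*`
has a homogeneous basis of degrees `w`. The local model is the sheaf of graded algebras associated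
with `V ↦ C^∞(V) ⊗ S(W*)`, and an isomorphism with it is a morphism `map` of presheaves of graded
algebras that is injective and locally surjective. -/
structure Chart {M : Type u} [TopologicalSpace M] (𝓞 : GradedAlgebraSheaf.{u, v} M) (n m : ℕ)
    (w : Fin m → ℤ) where
  /-- The underlying homeomorphism. -/
  φ : OpenPartialHomeomorph M (EuclideanSpace ℝ (Fin n))
  /-- The morphism of presheaves. -/
  map : ∀ V : Opens (EuclideanSpace ℝ (Fin n)), (V : Set (EuclideanSpace ℝ (Fin n))) ⊆ φ.target →
    SmoothFun V ⊗[ℝ] GradedSym w →ₐ[ℝ] 𝓞.sections (chartPreimage φ V)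
  map_mem : ∀ (V : Opens (EuclideanSpace ℝ (Fin n))) hV (f : SmoothFun V) (k : ℤ), ∀ s ∈ GradedSym.degree w k,
    map V hV (f ⊗ₜ s) ∈ 𝓞.degree (chartPreimage φ V) k
  map_res : ∀ (V V' : Opens (EuclideanSpace ℝ (Fin n))) hV hV' (h : V' ≤ V) (f : SmoothFun V) (s : GradedSym w),
    𝓞.res (chartPreimage_mono φ h) (map V hV (f ⊗ₜ s)) = map V' hV' (f.res h ⊗ₜ s)
  injective : ∀ (V : Opens (EuclideanSpace ℝ (Fin n))) hV, Function.Injective (map V hV)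
  locally_surjective : ∀ (V : Opens (EuclideanSpace ℝ (Fin n)))
    (hV : (V : Set (EuclideanSpace ℝ (Fin n))) ⊆ φ.target) (k : ℤ), ∀ g ∈ 𝓞.degree (chartPreimage φ V) k, ∀ x ∈ V, ∃ V', ∃ h : V' ≤ V, x ∈ V' ∧
      ∃ t, map V' (subset_trans h hV) t = 𝓞.res (chartPreimage_mono φ h) g

/-- A graded manifold with underlying space `M`: a sheaf of graded algebras that is locally
isomorphic to `(U, C^∞(U) ⊗ S(W*))` with `U ⊆ ℝⁿ` open and `W` a finite-dimensional graded vector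
space. -/
structure GradedManifold (M : Type u) [TopologicalSpace M] extends GradedAlgebraSheaf.{u, v} M where
  exists_chart : ∀ x : M, ∃ (n m : ℕ) (w : Fin m → ℤ) (c : Chart toGradedAlgebraSheaf n m w),
    x ∈ c.φ.source

namespace GradedManifold

variable {M : Type u} [TopologicalSpace M]

/-- The algebra `C^∞(ℳ)` of smooth functions, i.e. of global sections. -/
abbrev Functions (𝓜 : GradedManifold.{u, v} M) : Type v := 𝓜.sections ⊤

/-- The smooth functions of degree `k`. -/
abbrev functionsOfDegree (𝓜 : GradedManifold.{u, v} M) (k : ℤ) : Submodule ℝ 𝓜.Functions :=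
  𝓜.degree ⊤ k

/-- The graded vector fields of degree `l`. -/
abbrev VectorField (𝓜 : GradedManifold.{u, v} M) (l : ℤ) :
    Submodule ℝ (𝓜.Functions →ₗ[ℝ] 𝓜.Functions) :=
  GradedGeometry.VectorField 𝓜.functionsOfDegree l

/-- The Euler vector field of `𝓜`. -/
abbrev euler (𝓜 : GradedManifold.{u, v} M) : 𝓜.VectorField 0 :=
  GradedGeometry.euler 𝓜.functionsOfDegree

/-- The space in which differential `p`-forms live; `IsForm` singles them out. -/
abbrev Cochain (𝓜 : GradedManifold.{u, v} M) (p : ℕ) : Type v :=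
  GradedGeometry.Cochain 𝓜.functionsOfDegree p

/-- `α` is a differential `p`-form of degree `k` on `𝓜`. -/
abbrev IsForm (𝓜 : GradedManifold.{u, v} M) (p : ℕ) (k : ℤ) (α : 𝓜.Cochain p) : Prop :=
  GradedGeometry.IsForm (𝓜.comm ⊤) p k α

/-- `ω` is a graded symplectic form of degree `k`: a closed two-form of degree `k` such that
`X ↦ ι_X ω` is an isomorphism from vector fields onto one-forms (raising degrees by `k`). -/
structure IsSymplecticForm (𝓜 : GradedManifold.{u, v} M) (k : ℤ) (ω : 𝓜.Cochain 2) : Prop where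
  isForm : 𝓜.IsForm 2 k ω
  closed : d ω = 0
  nondegenerate : ∀ (l : ℤ) (β : 𝓜.Cochain 1), 𝓜.IsForm 1 (k + l) β →
    ∃! X : 𝓜.VectorField l, contract X ω = β

/-- `X` is symplectic: `L_X ω = 0`. -/
def IsSymplectic (𝓜 : GradedManifold.{u, v} M) (ω : 𝓜.Cochain 2) {l : ℤ} (X : 𝓜.VectorField l) :
    Prop :=
  lieDerivative X ω = 0

/-- `X` is Hamiltonian with Hamiltonian `H`: `ι_X ω = d H`. -/
def IsHamiltonianOf (𝓜 : GradedManifold.{u, v} M) (ω : 𝓜.Cochain 2) {l : ℤ}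
    (X : 𝓜.VectorField l) (H : 𝓜.Functions) : Prop :=
  contract X ω = d (p := 0) H

/-- `X` is Hamiltonian. -/
def IsHamiltonian (𝓜 : GradedManifold.{u, v} M) (ω : 𝓜.Cochain 2) {l : ℤ} (X : 𝓜.VectorField l) :
    Prop :=
  ∃ H : 𝓜.Functions, 𝓜.IsHamiltonianOf ω X H

end GradedManifold

end Manifold

end GradedGeometry

/-!
The proof is Cartan calculus with the Euler vector field `E`. Put `β = ι_X ω`, a one-form of degree
`k + l`. Since `dω = 0` and `L_X ω = 0`, the definition of `L_X` gives `dβ = 0`. The Lie derivative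
along `E` multiplies a form by its degree, so for the closed form `β` Cartan's formula reads
`d ι_E β = (k + l) β` (`GradedGeometry.d_contract_euler`), and one divides by `k + l`.

That `E` acts on `β` as the degree is checked on a vector field `Y` of degree `m`: the function
`β(Y)` has degree `k + l + m`, while `[E, Y] = m Y` (`GradedGeometry.coe_bracket_euler`), so
`E (β(Y)) - β([E, Y]) = (k + l) β(Y)`.
-/

namespace GradedGeometry

variable {A : Type v} [Ring A] [Algebra ℝ A] {𝒜 : ℤ → Submodule ℝ A}

/-- The value of a cochain on a vector field depends only on the underlying linear map, up to
rewriting the degree. -/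
theorem contract_congr {p : ℕ} (α : Cochain 𝒜 (p + 1)) {l m : ℤ} (h : l = m)
    {Y : VectorField 𝒜 l} {Z : VectorField 𝒜 m} (hYZ : Y.1 = Z.1) :
    contract Y α = contract Z α := by
  subst h
  rw [Subtype.ext hYZ]

theorem d_contract_eq_zero {p : ℕ} {ω : Cochain 𝒜 (p + 1)} (hω : d ω = 0) {l : ℤ}
    {X : VectorField 𝒜 l} (hX : lieDerivative X ω = 0) : d (contract X ω) = 0 := by
  have h0 : contract X (d ω) = 0 := congrFun (congrFun hω l) X
  rw [lieDerivative, h0, zero_add] at hX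
  exact (smul_eq_zero_iff_eq _).1 hX

variable [GradedAlgebra 𝒜]

theorem euler_apply_of_mem {n : ℤ} {f : A} (hf : f ∈ 𝒜 n) : (euler 𝒜).1 f = n • f := by
  lift f to 𝒜 n using hf
  rw [← Int.cast_smul_eq_zsmul ℝ]
  simp [euler, DirectSum.toModule_lof]

/-- `[E, Y] = |Y| Y`, as an equation of linear maps, because `bracket (euler 𝒜) Y` has the degree
`0 + m` and not `m`. -/
theorem coe_bracket_euler {m : ℤ} (Y : VectorField 𝒜 m) : (bracket (euler 𝒜) Y).1 = m • Y.1 := by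
  ext f
  change (euler 𝒜).1 (Y.1 f) - (0 * m).negOnePow • Y.1 ((euler 𝒜).1 f) = m • Y.1 f
  rw [zero_mul, Int.negOnePow_zero, one_smul]
  induction f using DirectSum.Decomposition.inductionOn 𝒜 with
  | zero => simp
  | @homogeneous i f =>
    rw [euler_apply_of_mem f.2, euler_apply_of_mem (Y.2.1 i f f.2), map_zsmul, add_smul,
      add_sub_cancel_left]
  | add f g hf hg =>
    simp only [map_add, smul_add, ← hf, ← hg]
    abel

theorem IsForm.contract_zsmul {hc : IsGradedCommutative 𝒜} {p : ℕ} {n : ℤ}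
    {α : Cochain 𝒜 (p + 1)} (hα : IsForm hc (p + 1) n α) {l : ℤ} (c : ℤ) (Y : VectorField 𝒜 l) :
    contract (c • Y) α = c • contract Y α :=
  map_zsmul (AddMonoidHom.mk' (fun Z : VectorField 𝒜 l => contract Z α) (hα.2.1 l)) c Y

/-- The Euler vector field acts on a one-form of degree `n` as multiplication by `n`. -/
theorem IsForm.act_euler {hc : IsGradedCommutative 𝒜} {n : ℤ} {β : Cochain 𝒜 1}
    (hβ : IsForm hc 1 n β) : act (euler 𝒜) β = n • β := by
  funext m Y
  have hbr : contract (bracket (euler 𝒜) Y) β = m • contract Y β := by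
    rw [contract_congr β (zero_add m) (Z := m • Y) (coe_bracket_euler Y), hβ.contract_zsmul]
  have hE : act (euler 𝒜) (p := 0) (contract Y β) = (n + m) • contract Y β :=
    euler_apply_of_mem (A := A) (hβ.1 m Y)
  change (0 * (m - 1)).negOnePow •
    (act (euler 𝒜) (p := 0) (contract Y β) - contract (bracket (euler 𝒜) Y) β) = n • contract Y β
  rw [hbr, hE, zero_mul, Int.negOnePow_zero, one_smul, add_smul, add_sub_cancel_right]

/-- Cartan's formula for `E` on a closed one-form: only the term `d ι_E β` is left. -/
theorem d_contract_euler {hc : IsGradedCommutative 𝒜} {n : ℤ} {β : Cochain 𝒜 1}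
    (hβ : IsForm hc 1 n β) (hd : d β = 0) : d (contract (euler 𝒜) β) = n • β := by
  have h : act (euler 𝒜) β - (0 : ℤ).negOnePow • d (contract (euler 𝒜) β) = 0 :=
    congrFun (congrFun hd 0) (euler 𝒜)
  rw [Int.negOnePow_zero, one_smul, sub_eq_zero, hβ.act_euler] at h
  exact h.symm

end GradedGeometry

theorem mainTheorem2 {M : Type u} [TopologicalSpace M] [T2Space M] [SecondCountableTopology M]
    (𝓜 : GradedGeometry.GradedManifold.{u, v} M) (k l : ℤ) (ω : 𝓜.Cochain 2)
    (hω : 𝓜.IsSymplecticForm k ω) (X : 𝓜.VectorField l) (hX : 𝓜.IsSymplectic ω X)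
    (hkl : k + l ≠ 0) :
    𝓜.IsHamiltonian ω X ∧
      ∀ H : 𝓜.Functions, H = GradedGeometry.contract 𝓜.euler (GradedGeometry.contract X ω) →
        𝓜.IsHamiltonianOf ω X (((k + l : ℤ) : ℝ)⁻¹ • H) := by
  have hβ := hω.isForm.1 l X
  have hd := GradedGeometry.d_contract_eq_zero hω.closed hX
  have hH : 𝓜.IsHamiltonianOf ω X
      (((k + l : ℤ) : ℝ)⁻¹ • (show 𝓜.Functions from
        GradedGeometry.contract 𝓜.euler (GradedGeometry.contract X ω))) := by
    have h := GradedGeometry.d_contract_euler hβ hd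
    funext m Y
    have hY : Y.1 (GradedGeometry.contract 𝓜.euler (GradedGeometry.contract X ω)) =
        (k + l) • (show 𝓜.Functions from
          GradedGeometry.contract Y (GradedGeometry.contract X ω)) :=
      congrFun (congrFun h m) Y
    refine Eq.symm ((map_smul Y.1 _ _).trans ?_)
    rw [hY, ← Int.cast_smul_eq_zsmul ℝ, inv_smul_smul₀ (Int.cast_ne_zero.2 hkl)]
    rfl
  exact ⟨⟨_, hH⟩, fun H h => h ▸ hH⟩
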